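/- Let $N=\{1,\dots,n\}$ be a finite set of players; a coalition is a nonempty subset of $N$. A stage game consists of a finite nonempty set $A$ of alternatives, generated payoffs $v:A\to\mathbb{R}^n$, and for each coalition $C$ an effectivity correspondence $E_C:A\rightrightarrows A$ with $a\in E_C(a)$ for all $a\in A$. A transfer matrix is $T=(T_{ij})_{i,j\in N}$ with $T_{ij}\ge 0$ (paid by $i$ to $j$), and experienced payoffs are $u_i(a,T)=v_i(a)+\sum_j T_{ji}-\sum_j T_{ij}$. An outcome is a triple $(a,C,T)$ of an alternative, a blocking coalition ($C=\emptyset$ if there is none) and a transfer matrix; a history is a finite (possibly empty) sequence of outcomes. A convention $\sigma$ assigns to each history $h$ an unblocked outcome $\sigma(h)=(a(h|\sigma),\emptyset,T(h|\sigma))$. For a discount factor $\delta\in[0,1)$ let $U_i(h|\sigma)$ be $(1-\delta)\sum_{t\ge 0}\delta^t$ times the experienced payoff of $i$ in the $t$-th period after $h$ when $\sigma$ is followed from $h$ on; only conventions for which these values are well defined and bounded across histories are considered. Let $\mathcal{S}$ be any set of coalitions, those that can make secret transfers. A convention respects $\mathcal{S}$-secret transfers if it makes the same recommendation after any two histories of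 equal length that have, in each period, the same alternative, the same blocking coalition $C$ (if any), and the same transfers $T_{ij}$ for all $i,j$, except possibly, when $C\in\mathcal{S}$, those with both $i,j\in C$. A stable convention is a convention that respects $\mathcal{S}$-secret transfers and is such that for no history $h$ do there exist a coalition $C$, an alternative $a'\in E_C(a(h|\sigma))$ and transfers $T'_C=(T'_{ij})_{i\in C,j\in N}$, $T'_{ij}\ge 0$, such that, writing $T'=[T'_C,T_{-C}(h|\sigma)]$ for the matrix with the rows of $T'_C$ for $i\in C$ and those of $T(h|\sigma)$ for $i\notin C$, every $i\in C$ has $$(1-\delta)\,u_i(a',T')+\delta\,U_i\big(h,(a',C,T')\,\big|\,\sigma\big)>U_i(h|\sigma).$$ Let $\underline v_C=\min_{a\in A}\max_{a'\in E_C(a)}\sum_{i\in C}v_i(a')$ and let $\mathcal{U}^\dagger$ be the convex hull of $\bigcup_{a\in A}\{u\in\mathbb{R}^n:\sum_{i\in N} u_i=\sum_{i\in N} v_i(a)\}$, the set of feasible payoffs. Let $\mathcal{D}(\mathcal{S})$ be the set of $u\in\mathcal{U}^\dagger$ such that $\sum_{i\in C}u_i\ge\underline v_C$ for every $C\in\mathcal{S}$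 and for every singleton $C=\{i\}$, $i\in N$, and let $\mathcal{D}^s(\mathcal{S})$ be the set of $u\in\mathcal{U}^\dagger$ for which all these inequalities are strict. Theorem. For every set $\mathcal{S}$ of coalitions that can make secret transfers and every $\delta\in[0,1)$, every stable convention $\sigma$ has its discounted payoff $U(\emptyset|\sigma)$ in $\mathcal{D}(\mathcal{S})$. If $\mathcal{D}^s(\mathcal{S})$ is non-empty, then for every $u\in\mathcal{D}^s(\mathcal{S})$ there is a $\underline\delta<1$ (one may take $\underline\delta\ge 0$) such that for every $\delta\in(\underline\delta,1)$ there is a stable convention with discounted payoff equal to $u$. -/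

import Mathlib

open scoped NNReal

noncomputable section

namespace SecretTransfers

/-- A stage game with player set `ι` and set of alternatives `A`: `v a i` is the payoff that
alternative `a` generates for player `i`, and `E C a` is the set of alternatives to which the
coalition `C` can move when `a` is recommended.  Coalitions are the nonempty sets of players, and
the effectivity correspondence of every coalition is reflexive. -/
structure StageGame (ι A : Type*) where
  v : A → ι → ℝ
  E : Finset ι → A → Set A
  refl : ∀ C : Finset ι, C.Nonempty → ∀ a : A, a ∈ E C a

/-- `T i j` is the (nonnegative) amount of utility transferred from player `i` to player `j`. -/
abbrev Transfers (ι : Type*) := ι → ι → ℝ≥0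

/-- An outcome of the stage game: the chosen alternative, the blocking coalition (`∅` if the
recommendation was not blocked) and the transfers. -/
@[ext]
structure Outcome (ι A : Type*) where
  alt : A
  blocker : Finset ι
  transfers : Transfers ι

/-- Finite sequences of outcomes, the first period first. -/
abbrev History (ι A : Type*) := List (Outcome ι A)

/-- A plan recommends an outcome after every history. -/
abbrev Plan (ι A : Type*) := History ι A → Outcome ι A

/-- A convention recommends only unblocked outcomes. -/
def IsConvention {ι A : Type*} (σ : Plan ι A) : Prop := ∀ h, (σ h).blocker = ∅

/-- The history reached `t` periods after `h` if the plan `σ` is followed from `h` on. -/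
def play {ι A : Type*} (σ : Plan ι A) (h : History ι A) : ℕ → History ι A
  | 0 => h
  | t + 1 => play σ h t ++ [σ (play σ h t)]

/-- The transfers that result when the members of `C` replace their rows of `T` by those of
`T'`. -/
def deviate {ι : Type*} [DecidableEq ι] (C : Finset ι) (T' T : Transfers ι) : Transfers ι :=
  fun i j => if i ∈ C then T' i j else T i j

/-- Two outcomes agree up to `S`-secret transfers: the alternative and the blocking coalition are
the same, and so are all transfers except those between members of a blocking coalition that
belongs to `S`. -/
def SameUpToSecret {ι A : Type*} (S : Set (Finset ι)) (o o' : Outcome ι A) : Prop :=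
  o.alt = o'.alt ∧ o.blocker = o'.blocker ∧
    ∀ i j, (o.blocker ∉ S ∨ ¬ (i ∈ o.blocker ∧ j ∈ o.blocker)) →
      o.transfers i j = o'.transfers i j

/-- `σ` gives the same recommendation after any two histories (of the same length) that are
identical up to `S`-secret transfers. -/
def RespectsSecret {ι A : Type*} (S : Set (Finset ι)) (σ : Plan ι A) : Prop :=
  ∀ h h' : History ι A, List.Forall₂ (SameUpToSecret S) h h' → σ h = σ h'

namespace StageGame

variable {ι A : Type*} [Fintype ι]

/-- Experienced payoff: generated payoff plus incoming minus outgoing transfers. -/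
def u (G : StageGame ι A) (a : A) (T : Transfers ι) (i : ι) : ℝ :=
  G.v a i + ∑ j, (T j i : ℝ) - ∑ j, (T i j : ℝ)

/-- The stage payoff of player `i`, `t` periods after `h`, if `σ` is followed from `h` on. -/
def stagePayoff (G : StageGame ι A) (σ : Plan ι A) (h : History ι A) (i : ι) (t : ℕ) : ℝ :=
  G.u (σ (play σ h t)).alt (σ (play σ h t)).transfers i

/-- The normalized discounted continuation payoff of player `i` after the history `h`. -/
def U (G : StageGame ι A) (δ : ℝ) (σ : Plan ι A) (h : History ι A) (i : ι) : ℝ :=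
  (1 - δ) * ∑' t : ℕ, δ ^ t * G.stagePayoff σ h i t

/-- The continuation values are well defined and bounded across histories. -/
def BoundedValues (G : StageGame ι A) (δ : ℝ) (σ : Plan ι A) : Prop :=
  (∀ h i, Summable fun t : ℕ => δ ^ t * G.stagePayoff σ h i t) ∧
    Bornology.IsBounded (Set.range fun h : History ι A => G.U δ σ h)

/-- After no history is there a coalition `C` with a one-shot deviation, to an alternative that
`C` can move to and to transfers in which only the members of `C` change what they pay, from which
every member of `C` strictly gains. -/
def NoProfitableDeviation [DecidableEq ι] (G : StageGame ι A) (δ : ℝ) (σ : Plan ι A) : Prop :=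
  ∀ h : History ι A, ¬ ∃ (C : Finset ι) (a' : A) (T' : Transfers ι),
    C.Nonempty ∧ a' ∈ G.E C (σ h).alt ∧
    ∀ i ∈ C, (1 - δ) * G.u a' (deviate C T' (σ h).transfers) i
      + δ * G.U δ σ (h ++ [⟨a', C, deviate C T' (σ h).transfers⟩]) i > G.U δ σ h i

/-- Stable conventions when exactly the coalitions in `S` can make secret transfers. -/
structure IsStableConvention [DecidableEq ι] (G : StageGame ι A) (S : Set (Finset ι)) (δ : ℝ)
    (σ : Plan ι A) : Prop where
  convention : IsConvention σ
  bounded : G.BoundedValues δ σ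
  secret : RespectsSecret S σ
  stable : G.NoProfitableDeviation δ σ

/-- The minmax of the coalition `C`:
the minimum over `a` of the maximum over `a' ∈ E C a` of the total generated payoff of `C`. -/
def minmax (G : StageGame ι A) (C : Finset ι) : ℝ :=
  ⨅ a : A, ⨆ a' : G.E C a, ∑ i ∈ C, G.v a' i

/-- The payoff profiles that are feasible with transfers: the convex hull of all profiles in which
the total payoff equals the total generated by some alternative. -/
def feasible (G : StageGame ι A) : Set (ι → ℝ) :=
  convexHull ℝ (⋃ a : A, {w : ι → ℝ | ∑ i, w i = ∑ i, G.v a i})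

/-- The `S`-rational payoffs: feasible payoffs that give every coalition in `S` and every single
player at least its minmax. -/
def rational (G : StageGame ι A) (S : Set (Finset ι)) : Set (ι → ℝ) :=
  {w | w ∈ G.feasible ∧
    ∀ C ∈ S ∪ Set.range (fun i : ι => ({i} : Finset ι)), G.minmax C ≤ ∑ i ∈ C, w i}

/-- The strictly `S`-rational payoffs: feasible payoffs that give every coalition in `S` and every
single player strictly more than its minmax. -/
def strictlyRational (G : StageGame ι A) (S : Set (Finset ι)) : Set (ι → ℝ) :=
  {w | w ∈ G.feasible ∧
    ∀ C ∈ S ∪ Set.range (fun i : ι => ({i} : Finset ι)), G.minmax C < ∑ i ∈ C, w i}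

end StageGame

end SecretTransfers

end

/-! Necessity. Let `C` be in `S` or a singleton, and let `m` be the infimum over histories of its
total continuation value. At any history `C` can move to an alternative that generates at least its
minmax, stop all its payments, and split the proceeds by transfers inside `C`. These transfers are
secret (or absent, for a singleton), so the continuation does not depend on the split, and any gain
in the total can be made a gain for every member. Stability therefore forces `m ≥ (1 - δ) * minmax +
δ * m`, that is, `m ≥ minmax` (`minmax_step`, `minmax_le_sum_U`). Feasibility holds because
transfers cancel in the total.

Sufficiency. Every punishable set `D` (a member of `S` or a singleton) gets its own path: `L`
periods at an alternative that minmaxes `D`, without transfers, and then payoffs based on a profile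
`x D`, which is worse for the total of `D` than the profile of any other path
(`exists_punishment_payoffs`). A deviation by `C` in `S` starts the path of `C`. This ignores the
secret transfers, and it deters because the total of `C` falls. A deviation by any other coalition
is fully observed, so one member who does not gain can be singled out and punished. Such a member
exists because transfers inside the coalition cancel, so its total stage payoff is bounded. First
`L` is taken large enough that the minmax phase outweighs a one-period gain, and then `δ` close to 1
makes the differences between the profiles decisive. -/

namespace SecretTransfers

/-! ### Transfers, minmax alternatives and feasible totals. -/

variable {ι A : Type*}

/-- The transfers among the members of `C` with net receipts `z`, if these add up to zero. -/
noncomputable def innerTransfers [DecidableEq ι] (C : Finset ι) (z : ι → ℝ) : Transfers ι :=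
  fun i j => if i ∈ C ∧ j ∈ C then ((z j - z i) / C.card).toNNReal else 0

/-- The positive parts of a number and of its negative differ by that number, so the net flow from
`j` to `i` is `(z i - z j) / C.card`. Summed over `j ∈ C` this leaves `z i`. -/
lemma net_innerTransfers [Fintype ι] [DecidableEq ι] {C : Finset ι} {z : ι → ℝ}
    (hz : ∑ i ∈ C, z i = 0) {i : ι} (hi : i ∈ C) :
    ∑ j, (innerTransfers C z j i : ℝ) - ∑ j, (innerTransfers C z i j : ℝ) = z i := by
  have hc : (C.card : ℝ) ≠ 0 := by
    exact_mod_cast (Finset.card_pos.2 ⟨i, hi⟩).ne'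
  have key : ∀ j, (innerTransfers C z j i : ℝ) - (innerTransfers C z i j : ℝ)
      = if j ∈ C then (z i - z j) / C.card else 0 := by
    intro j
    by_cases hj : j ∈ C
    · simp only [innerTransfers, hi, hj, and_self, if_true, Real.coe_toNNReal']
      have : (z j - z i) / (C.card : ℝ) = -((z i - z j) / C.card) := by ring
      rw [this]
      rcases le_total 0 ((z i - z j) / (C.card : ℝ)) with h | h
      · rw [max_eq_left h, max_eq_right (neg_nonpos.2 h), sub_zero]
      · rw [max_eq_right h, max_eq_left (neg_nonneg.2 h), zero_sub, neg_neg]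
    · simp [innerTransfers, hj]
  rw [← Finset.sum_sub_distrib, Finset.sum_congr rfl fun j _ => key j, Finset.sum_ite_mem,
    Finset.univ_inter, ← Finset.sum_div, Finset.sum_sub_distrib, hz, Finset.sum_const,
    nsmul_eq_mul]
  field_simp
  ring

lemma innerTransfers_singleton [DecidableEq ι] (k : ι) (z : ι → ℝ) :
    innerTransfers {k} z = 0 := by
  funext i j
  simp only [innerTransfers, Finset.mem_singleton, Pi.zero_apply]
  split_ifs with h
  · rw [h.1, h.2]; simp
  · rfl

lemma SameUpToSecret.refl (S : Set (Finset ι)) (o : Outcome ι A) : SameUpToSecret S o o :=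
  ⟨rfl, rfl, fun _ _ _ => rfl⟩

lemma play_sameUpToSecret {S : Set (Finset ι)} {σ : Plan ι A} (hσ : RespectsSecret S σ)
    {h h' : History ι A} (hh : List.Forall₂ (SameUpToSecret S) h h') (t : ℕ) :
    List.Forall₂ (SameUpToSecret S) (play σ h t) (play σ h' t) := by
  induction t with
  | zero => exact hh
  | succ t ih =>
    simp only [play]
    refine List.rel_append ih ?_
    rw [hσ _ _ ih]
    exact List.Forall₂.cons (SameUpToSecret.refl S _) List.Forall₂.nil

namespace StageGame

variable [Fintype ι]

lemma U_congr_of_sameUpToSecret (G : StageGame ι A) (δ : ℝ) {S : Set (Finset ι)} {σ : Plan ι A}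
    (hσ : RespectsSecret S σ) {h h' : History ι A}
    (hh : List.Forall₂ (SameUpToSecret S) h h') : G.U δ σ h = G.U δ σ h' := by
  funext i
  simp only [U, stagePayoff, hσ _ _ (play_sameUpToSecret hσ hh _)]

lemma u_add (G : StageGame ι A) (a : A) (T T' : Transfers ι) (i : ι) :
    G.u a (T + T') i = G.u a T i + (∑ j, (T' j i : ℝ) - ∑ j, (T' i j : ℝ)) := by
  simp only [u, Pi.add_apply, NNReal.coe_add, Finset.sum_add_distrib]
  ring

lemma sum_u (G : StageGame ι A) (a : A) (T : Transfers ι) :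
    ∑ i, G.u a T i = ∑ i, G.v a i := by
  simp only [u, Finset.sum_sub_distrib, Finset.sum_add_distrib]
  rw [Finset.sum_comm]
  ring

lemma u_innerTransfers_univ [DecidableEq ι] (G : StageGame ι A) (a : A) {r : ι → ℝ}
    (hr : ∑ i, r i = ∑ i, G.v a i) :
    G.u a (innerTransfers Finset.univ (r - G.v a)) = r := by
  funext i
  have := net_innerTransfers (C := Finset.univ) (z := r - G.v a) (by simp [hr]) (Finset.mem_univ i)
  simp only [u, Pi.sub_apply] at this ⊢
  linarith

lemma v_le_u_deviate_zero [DecidableEq ι] (G : StageGame ι A) (a : A) (C : Finset ι)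
    (T : Transfers ι) {i : ι} (hi : i ∈ C) : G.v a i ≤ G.u a (deviate C 0 T) i := by
  have h : ∑ j, ((deviate C 0 T i j : ℝ≥0) : ℝ) = 0 := by simp [deviate, hi]
  have h' : 0 ≤ ∑ j, ((deviate C 0 T j i : ℝ≥0) : ℝ) := Finset.sum_nonneg fun _ _ => by positivity
  simp only [u]
  linarith

/-- A deviating coalition keeps at most what it generates and what it receives from outside. -/
lemma sum_u_deviate_le [DecidableEq ι] (G : StageGame ι A) (a : A) (C : Finset ι)
    (T' T : Transfers ι) :
    ∑ i ∈ C, G.u a (deviate C T' T) i ≤ ∑ i ∈ C, G.v a i + ∑ i, ∑ j, (T i j : ℝ) := by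
  set D := deviate C T' T with hD
  have h1 : ∀ f : ι → ℝ, ∑ j, f j = ∑ j ∈ C, f j + ∑ j ∈ Cᶜ, f j :=
    fun f => (Finset.sum_add_sum_compl C f).symm
  have h2 : ∑ i ∈ C, ∑ j, (D j i : ℝ)
      = ∑ i ∈ C, ∑ j ∈ C, (D j i : ℝ) + ∑ i ∈ C, ∑ j ∈ Cᶜ, (T j i : ℝ) := by
    rw [← Finset.sum_add_distrib]
    refine Finset.sum_congr rfl fun i _ => ?_
    rw [h1]
    congr 1
    refine Finset.sum_congr rfl fun j hj => ?_
    simp [hD, deviate, Finset.mem_compl.1 hj]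
  have h3 : ∑ i ∈ C, ∑ j ∈ C, (D i j : ℝ) ≤ ∑ i ∈ C, ∑ j, (D i j : ℝ) :=
    Finset.sum_le_sum fun i _ => Finset.sum_le_sum_of_subset_of_nonneg (Finset.subset_univ _)
      fun _ _ _ => by positivity
  have h4 : ∑ i ∈ C, ∑ j ∈ Cᶜ, (T j i : ℝ) ≤ ∑ i, ∑ j, (T i j : ℝ) := by
    rw [Finset.sum_comm (s := Finset.univ)]
    calc ∑ i ∈ C, ∑ j ∈ Cᶜ, (T j i : ℝ) ≤ ∑ i ∈ C, ∑ j, (T j i : ℝ) :=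
          Finset.sum_le_sum fun i _ => Finset.sum_le_sum_of_subset_of_nonneg
            (Finset.subset_univ _) fun _ _ _ => by positivity
      _ ≤ _ := Finset.sum_le_sum_of_subset_of_nonneg (Finset.subset_univ _)
            fun _ _ _ => Finset.sum_nonneg fun _ _ => by positivity
  have h5 : ∑ i ∈ C, ∑ j ∈ C, (D j i : ℝ) = ∑ i ∈ C, ∑ j ∈ C, (D i j : ℝ) := Finset.sum_comm
  simp only [u, Finset.sum_sub_distrib, Finset.sum_add_distrib]
  linarith

omit [Fintype ι] in
lemma exists_forall_sum_le_minmax [Finite A] [Nonempty A] (G : StageGame ι A) (C : Finset ι) :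
    ∃ a, ∀ a' ∈ G.E C a, ∑ i ∈ C, G.v a' i ≤ G.minmax C := by
  obtain ⟨a, ha⟩ := exists_eq_ciInf_of_finite (f := fun a : A => ⨆ a' : G.E C a, ∑ i ∈ C, G.v a' i)
  refine ⟨a, fun a' ha' => ?_⟩
  rw [minmax, ← ha]
  exact le_ciSup (f := fun a' : G.E C a => ∑ i ∈ C, G.v a' i) (Set.finite_range _).bddAbove ⟨a', ha'⟩

omit [Fintype ι] in
lemma exists_minmax_le_sum [Finite A] (G : StageGame ι A) {C : Finset ι} (hC : C.Nonempty) (a : A) :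
    ∃ a' ∈ G.E C a, G.minmax C ≤ ∑ i ∈ C, G.v a' i := by
  have : Nonempty (G.E C a) := ⟨⟨a, G.refl C hC a⟩⟩
  obtain ⟨a', ha'⟩ := exists_eq_ciSup_of_finite (f := fun a' : G.E C a => ∑ i ∈ C, G.v a' i)
  refine ⟨a', a'.2, ?_⟩
  rw [ha', minmax]
  exact ciInf_le (f := fun a : A => ⨆ a' : G.E C a, ∑ i ∈ C, G.v a' i)
    (Set.finite_range _).bddBelow a

lemma exists_le_sum_le_of_mem_feasible [Finite A] [Nonempty A] (G : StageGame ι A) {w : ι → ℝ}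
    (hw : w ∈ G.feasible) : ∃ lo hi, ∑ i, G.v lo i ≤ ∑ i, w i ∧ ∑ i, w i ≤ ∑ i, G.v hi i := by
  obtain ⟨lo, hlo⟩ := Finite.exists_min fun a => ∑ i, G.v a i
  obtain ⟨hi, hhi⟩ := Finite.exists_max fun a => ∑ i, G.v a i
  let s : (ι → ℝ) →ₗ[ℝ] ℝ := ∑ i, LinearMap.proj i
  have hs : ∀ x, s x = ∑ i, x i := fun x => by simp [s]
  have : G.feasible ⊆ s ⁻¹' Set.Icc (∑ i, G.v lo i) (∑ i, G.v hi i) := by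
    refine convexHull_min ?_ ((convex_Icc _ _).linear_preimage s)
    intro x hx
    obtain ⟨a, ha⟩ := Set.mem_iUnion.1 hx
    simp only [Set.mem_ofPred_eq] at ha
    simp only [Set.mem_preimage, hs, ha]
    exact ⟨hlo a, hhi a⟩
  have h := this hw
  simp only [Set.mem_preimage, hs] at h
  exact ⟨lo, hi, h⟩

/-- Shifting all coordinates of `w` equally reaches the hyperplanes of `lo` and of `hi`, and `w`
lies on the segment between the two shifted points. Together with `exists_le_sum_le_of_mem_feasible`
this makes feasibility a condition on the total alone. -/
lemma mem_feasible_of_le_sum_le (G : StageGame ι A) {w : ι → ℝ} {lo hi : A}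
    (hlo : ∑ i, G.v lo i ≤ ∑ i, w i) (hhi : ∑ i, w i ≤ ∑ i, G.v hi i) : w ∈ G.feasible := by
  have hmem : ∀ (x : ι → ℝ) (a : A), ∑ i, x i = ∑ i, G.v a i → x ∈ G.feasible := fun x a h =>
    subset_convexHull ℝ _ (Set.mem_iUnion.2 ⟨a, h⟩)
  rcases isEmpty_or_nonempty ι with hι | hι
  · exact hmem w lo (by simp)
  have hn : (Fintype.card ι : ℝ) ≠ 0 := by exact_mod_cast Fintype.card_ne_zero
  set X := ∑ i, w i with hX
  set shift : ℝ → ι → ℝ := fun s i => w i + (s - X) / Fintype.card ι with hshift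
  have hsum : ∀ s, ∑ i, shift s i = s := fun s => by
    simp only [hshift, Finset.sum_add_distrib, Finset.sum_const, Finset.card_univ, nsmul_eq_mul]
    field_simp
    linarith
  have h1 := hmem (shift (∑ i, G.v lo i)) lo (hsum _)
  have h2 := hmem (shift (∑ i, G.v hi i)) hi (hsum _)
  have hX' : X ∈ segment ℝ (∑ i, G.v lo i) (∑ i, G.v hi i) := by
    rw [segment_eq_Icc (hlo.trans hhi)]; exact ⟨hlo, hhi⟩
  obtain ⟨p, q, hp, hq, hpq, hc⟩ := hX'
  have : p • shift (∑ i, G.v lo i) + q • shift (∑ i, G.v hi i) = w := by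
    funext i
    simp only [hshift, Pi.add_apply, Pi.smul_apply, smul_eq_mul] at hc ⊢
    have hp' : p = 1 - q := by linarith
    subst hp'
    field_simp
    linear_combination hc
  rw [← this]
  exact convex_convexHull ℝ _ h1 h2 hp hq hpq

lemma U_mem_feasible [Finite A] [Nonempty A] (G : StageGame ι A) {δ : ℝ} (h0 : 0 ≤ δ) (h1 : δ < 1) {σ : Plan ι A}
    (hσ : G.BoundedValues δ σ) (h : History ι A) : G.U δ σ h ∈ G.feasible := by
  obtain ⟨lo, hlo⟩ := Finite.exists_min fun a => ∑ i, G.v a i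
  obtain ⟨hi, hhi⟩ := Finite.exists_max fun a => ∑ i, G.v a i
  have hsum : ∑ i, G.U δ σ h i
      = (1 - δ) * ∑' t : ℕ, δ ^ t * ∑ i, G.v (σ (play σ h t)).alt i := by
    simp only [U]
    rw [← Finset.mul_sum, ← Summable.tsum_finsetSum fun i _ => hσ.1 h i]
    congr 1
    refine tsum_congr fun t => ?_
    rw [← Finset.mul_sum]
    simp only [stagePayoff, sum_u]
  have hsm : Summable fun t : ℕ => δ ^ t * ∑ i, G.v (σ (play σ h t)).alt i := by
    have := summable_sum (s := Finset.univ) fun i _ => hσ.1 h i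
    refine this.congr fun t => ?_
    rw [← Finset.mul_sum]
    simp only [stagePayoff, sum_u]
  have hg := summable_geometric_of_lt_one h0 h1
  have hδ : 0 < 1 - δ := by linarith
  have hconst : ∀ c : ℝ, (1 - δ) * ∑' t : ℕ, δ ^ t * c = c := fun c => by
    rw [tsum_mul_right, tsum_geometric_of_lt_one h0 h1]
    field_simp
  refine G.mem_feasible_of_le_sum_le (lo := lo) (hi := hi) ?_ ?_
  · rw [hsum, ← hconst (∑ i, G.v lo i)]
    refine mul_le_mul_of_nonneg_left ?_ hδ.le
    exact (hg.mul_right _).tsum_le_tsum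
      (fun t => mul_le_mul_of_nonneg_left (hlo _) (pow_nonneg h0 t)) hsm
  · rw [hsum, ← hconst (∑ i, G.v hi i)]
    refine mul_le_mul_of_nonneg_left ?_ hδ.le
    exact hsm.tsum_le_tsum
      (fun t => mul_le_mul_of_nonneg_left (hhi _) (pow_nonneg h0 t)) (hg.mul_right _)

/-! ### Necessity: coalitions with secret transfers secure their minmax. -/

section Necessity

variable [DecidableEq ι] [Finite A]

/-- If the bound failed, `C` could block with a minmax reply and no payments, raise its total, and
share the surplus by inner transfers that leave the continuation unchanged. -/
lemma minmax_step (G : StageGame ι A) {S : Set (Finset ι)} {δ : ℝ} (h0 : 0 ≤ δ) (h1 : δ < 1)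
    {σ : Plan ι A} (hσ : G.IsStableConvention S δ σ) {C : Finset ι} (hC : C.Nonempty)
    (hCS : C ∈ S ∨ ∃ k, C = {k}) {m : ℝ} (hm : ∀ h, m ≤ ∑ i ∈ C, G.U δ σ h i)
    (h : History ι A) : (1 - δ) * G.minmax C + δ * m ≤ ∑ i ∈ C, G.U δ σ h i := by
  by_contra! hlt
  have hδ : 0 < 1 - δ := by linarith
  have hc : (0 : ℝ) < C.card := by exact_mod_cast hC.card_pos
  obtain ⟨a', ha', hva⟩ := G.exists_minmax_le_sum hC (σ h).alt
  set T := (σ h).transfers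
  set h₀ : History ι A := h ++ [⟨a', C, deviate C 0 T⟩] with hh₀
  set x : ι → ℝ := fun i => (1 - δ) * G.u a' (deviate C 0 T) i + δ * G.U δ σ h₀ i with hx
  have hxsum : ∑ i ∈ C, G.U δ σ h i < ∑ i ∈ C, x i := by
    refine hlt.trans_le ?_
    simp only [hx, Finset.sum_add_distrib, ← Finset.mul_sum]
    have := Finset.sum_le_sum fun i (hi : i ∈ C) => G.v_le_u_deviate_zero a' C T hi
    exact add_le_add (mul_le_mul_of_nonneg_left (hva.trans this) hδ.le)
      (mul_le_mul_of_nonneg_left (hm h₀) h0)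
  set g := (∑ i ∈ C, x i - ∑ i ∈ C, G.U δ σ h i) / C.card with hg
  have hgpos : 0 < g := div_pos (by linarith) hc
  -- The inner transfers are chosen so that every member ends up exactly `g` above its equilibrium
  -- value. The division by `1 - δ` is there because they are paid in one period only.
  set z : ι → ℝ := fun i => (G.U δ σ h i - x i + g) / (1 - δ) with hz
  have hzsum : ∑ i ∈ C, z i = 0 := by
    simp only [hz, ← Finset.sum_div, Finset.sum_add_distrib, Finset.sum_sub_distrib,
      Finset.sum_const, nsmul_eq_mul, hg]
    field_simp
    ring
  have hdev : deviate C (innerTransfers C z) T = deviate C 0 T + innerTransfers C z := by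
    funext i j
    by_cases hi : i ∈ C <;> simp [deviate, innerTransfers, hi]
  have hcont : G.U δ σ (h ++ [⟨a', C, deviate C (innerTransfers C z) T⟩]) = G.U δ σ h₀ := by
    rcases hCS with hCS | ⟨k, rfl⟩
    · refine G.U_congr_of_sameUpToSecret δ hσ.secret (List.rel_append ?_ ?_)
      · exact List.forall₂_same.2 fun o _ => SameUpToSecret.refl S o
      · refine List.Forall₂.cons ⟨rfl, rfl, fun i j hij => ?_⟩ List.Forall₂.nil
        have hij : ¬ (i ∈ C ∧ j ∈ C) := hij.resolve_left (not_not.2 hCS)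
        rw [hdev]
        simp [innerTransfers, hij]
    · rw [hh₀, innerTransfers_singleton]
  refine hσ.stable h ⟨C, a', innerTransfers C z, hC, ha', fun i hi => ?_⟩
  rw [hcont, hdev, u_add, net_innerTransfers hzsum hi]
  have : (1 - δ) * z i = G.U δ σ h i - x i + g := by
    simp only [hz]
    field_simp
  have hxi : x i = (1 - δ) * G.u a' (deviate C 0 T) i + δ * G.U δ σ h₀ i := rfl
  linarith

lemma minmax_le_sum_U (G : StageGame ι A) {S : Set (Finset ι)} {δ : ℝ} (h0 : 0 ≤ δ) (h1 : δ < 1)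
    {σ : Plan ι A} (hσ : G.IsStableConvention S δ σ) {C : Finset ι} (hC : C.Nonempty)
    (hCS : C ∈ S ∨ ∃ k, C = {k}) (h : History ι A) : G.minmax C ≤ ∑ i ∈ C, G.U δ σ h i := by
  obtain ⟨R, hR⟩ := hσ.bounded.2.exists_norm_le
  have hbdd : BddBelow (Set.range fun h => ∑ i ∈ C, G.U δ σ h i) := by
    refine ⟨-∑ i ∈ C, R, ?_⟩
    rintro _ ⟨h, rfl⟩
    rw [← Finset.sum_neg_distrib]
    refine Finset.sum_le_sum fun i _ => ?_
    have := (norm_le_pi_norm (G.U δ σ h) i).trans (hR _ ⟨h, rfl⟩)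
    exact (abs_le.1 this).1
  have hinf := le_ciInf (G.minmax_step h0 h1 hσ hC hCS (ciInf_le hbdd))
  -- With `m` the infimum itself, `hinf` reads `(1 - δ) * minmax + δ * m ≤ m`, and `1 - δ` is
  -- positive.
  have : G.minmax C ≤ ⨅ h, ∑ i ∈ C, G.U δ σ h i := by nlinarith
  exact this.trans (ciInf_le hbdd h)

theorem IsStableConvention.U_mem_rational [Nonempty A] {G : StageGame ι A} {S : Set (Finset ι)}
    (hS : ∀ C ∈ S, C.Nonempty) {δ : ℝ} (h0 : 0 ≤ δ) (h1 : δ < 1) {σ : Plan ι A}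
    (hσ : G.IsStableConvention S δ σ) (h : History ι A) : G.U δ σ h ∈ G.rational S := by
  refine ⟨G.U_mem_feasible h0 h1 hσ.bounded h, fun C hC => ?_⟩
  rcases hC with hC | ⟨k, rfl⟩
  · exact G.minmax_le_sum_U h0 h1 hσ (hS C hC) (Or.inl hC) h
  · exact G.minmax_le_sum_U h0 h1 hσ (Finset.singleton_nonempty k) (Or.inr ⟨k, rfl⟩) h

end Necessity

end StageGame

end SecretTransfers

/-! ### Values and stability of automaton plans. -/

namespace SecretTransfers

variable {ι A Q : Type*}

/-- The plan of an automaton with initial state `q₀`, transitions `next` and outputs `out`. -/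
def automatonPlan (next : Q → Outcome ι A → Q) (out : Q → Outcome ι A) (q₀ : Q) : Plan ι A :=
  fun h => out (h.foldl next q₀)

section Automaton

variable {next : Q → Outcome ι A → Q} {out : Q → Outcome ι A} {q₀ : Q}

lemma foldl_play_automatonPlan (h : History ι A) (t : ℕ) :
    (play (automatonPlan next out q₀) h t).foldl next q₀
      = (fun q => next q (out q))^[t] (h.foldl next q₀) := by
  induction t with
  | zero => rfl
  | succ t ih =>
    rw [play, List.foldl_append, Function.iterate_succ_apply', ← ih]
    rfl

lemma respectsSecret_automatonPlan {S : Set (Finset ι)}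
    (hnext : ∀ q o o', SameUpToSecret S o o' → next q o = next q o') :
    RespectsSecret S (automatonPlan next out q₀) := by
  intro h h' hh
  have : ∀ q, h.foldl next q = h'.foldl next q := by
    induction hh with
    | nil => exact fun _ => rfl
    | cons ho _ ih =>
      intro q
      rw [List.foldl_cons, List.foldl_cons, hnext q _ _ ho, ih]
  simp only [automatonPlan, this]

variable [Fintype ι]

/-- By the recursion for `V` the discounted stage payoffs telescope, and boundedness of `V` sends
the remaining term to zero. A bounded solution of the recursion is therefore the value function. -/
lemma StageGame.hasSum_automatonPlan (G : StageGame ι A) {δ : ℝ} (h0 : 0 ≤ δ) (h1 : δ < 1)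
    {V : Q → ι → ℝ} {R : ℝ} (hR : ∀ q i, |V q i| ≤ R)
    (hV : ∀ q i, V q i = (1 - δ) * G.u (out q).alt (out q).transfers i
      + δ * V (next q (out q)) i) (h : History ι A) (i : ι) :
    HasSum (fun t : ℕ => δ ^ t * G.stagePayoff (automatonPlan next out q₀) h i t)
      (V (h.foldl next q₀) i / (1 - δ)) := by
  have hδ : 0 < 1 - δ := by linarith
  set f : Q → Q := fun q => next q (out q) with hf
  set q := h.foldl next q₀ with hq
  have hstage : ∀ t, G.stagePayoff (automatonPlan next out q₀) h i t
      = (V (f^[t] q) i - δ * V (f^[t + 1] q) i) / (1 - δ) := by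
    intro t
    rw [stagePayoff, automatonPlan, foldl_play_automatonPlan, Function.iterate_succ_apply',
      ← hf, ← hq, hV (f^[t] q) i]
    field_simp
    ring
  have hterm : ∀ t, δ ^ t * G.stagePayoff (automatonPlan next out q₀) h i t
      = δ ^ t * V (f^[t] q) i / (1 - δ) - δ ^ (t + 1) * V (f^[t + 1] q) i / (1 - δ) := by
    intro t
    rw [hstage]
    ring
  have hlim : Filter.Tendsto (fun t : ℕ => δ ^ t * V (f^[t] q) i / (1 - δ)) Filter.atTop
      (nhds 0) := by
    have hg := (tendsto_pow_atTop_nhds_zero_of_lt_one h0 h1).mul_const (R / (1 - δ))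
    rw [zero_mul] at hg
    refine squeeze_zero_norm (fun t => ?_) hg
    rw [Real.norm_eq_abs, abs_div, abs_mul, abs_of_pos hδ, abs_of_nonneg (pow_nonneg h0 t),
      mul_div_assoc]
    have := hR (f^[t] q) i
    gcongr
  have hsum : Summable fun t : ℕ => δ ^ t * G.stagePayoff (automatonPlan next out q₀) h i t := by
    refine Summable.of_norm_bounded
      ((summable_geometric_of_lt_one h0 h1).mul_right ((R + R) / (1 - δ))) fun t => ?_
    rw [hstage, Real.norm_eq_abs, abs_mul, abs_div, abs_of_pos hδ, abs_of_nonneg (pow_nonneg h0 t)]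
    have h2 : |V (f^[t] q) i - δ * V (f^[t + 1] q) i| ≤ R + R := by
      refine (abs_sub _ _).trans (add_le_add (hR _ _) ?_)
      rw [abs_mul, abs_of_nonneg h0]
      exact (mul_le_of_le_one_left (abs_nonneg _) h1.le).trans (hR _ _)
    gcongr
  rw [hsum.hasSum_iff_tendsto_nat]
  have hpart : ∀ n : ℕ, ∑ t ∈ Finset.range n,
      δ ^ t * G.stagePayoff (automatonPlan next out q₀) h i t
      = V q i / (1 - δ) - δ ^ n * V (f^[n] q) i / (1 - δ) := by
    intro n
    rw [Finset.sum_congr rfl fun t _ => hterm t,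
      Finset.sum_range_sub' fun t => δ ^ t * V (f^[t] q) i / (1 - δ)]
    simp
  simp only [hpart]
  simpa using tendsto_const_nhds.sub hlim

lemma StageGame.U_automatonPlan (G : StageGame ι A) {δ : ℝ} (h0 : 0 ≤ δ) (h1 : δ < 1)
    {V : Q → ι → ℝ} {R : ℝ} (hR : ∀ q i, |V q i| ≤ R)
    (hV : ∀ q i, V q i = (1 - δ) * G.u (out q).alt (out q).transfers i
      + δ * V (next q (out q)) i) (h : History ι A) :
    G.U δ (automatonPlan next out q₀) h = V (h.foldl next q₀) := by
  funext i
  have hδ : 0 < 1 - δ := by linarith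
  rw [U, (G.hasSum_automatonPlan h0 h1 hR hV h i).tsum_eq]
  field_simp

lemma StageGame.isStableConvention_automatonPlan [DecidableEq ι] (G : StageGame ι A)
    {S : Set (Finset ι)} {δ : ℝ} (h0 : 0 ≤ δ) (h1 : δ < 1)
    {V : Q → ι → ℝ} {R : ℝ} (hR : ∀ q i, |V q i| ≤ R)
    (hV : ∀ q i, V q i = (1 - δ) * G.u (out q).alt (out q).transfers i
      + δ * V (next q (out q)) i)
    (hout : ∀ q, (out q).blocker = ∅)
    (hnext : ∀ q o o', SameUpToSecret S o o' → next q o = next q o')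
    (hstable : ∀ (q : Q) (C : Finset ι), C.Nonempty → ∀ a' ∈ G.E C (out q).alt,
      ∀ T' : Transfers ι, ∃ i ∈ C, (1 - δ) * G.u a' (deviate C T' (out q).transfers) i
        + δ * V (next q ⟨a', C, deviate C T' (out q).transfers⟩) i ≤ V q i) :
    G.IsStableConvention S δ (automatonPlan next out q₀) where
  convention _ := hout _
  bounded := by
    refine ⟨fun h i => (G.hasSum_automatonPlan h0 h1 hR hV h i).summable, ?_⟩
    refine isBounded_iff_forall_norm_le.2 ⟨|R|, ?_⟩
    rintro _ ⟨h, rfl⟩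
    simp only [G.U_automatonPlan h0 h1 hR hV]
    exact (pi_norm_le_iff_of_nonneg (abs_nonneg R)).2 fun i => (hR _ i).trans (le_abs_self R)
  secret := respectsSecret_automatonPlan hnext
  stable := by
    rintro h ⟨C, a', T', hC, ha', hgain⟩
    obtain ⟨i, hi, hle⟩ := hstable _ C hC a' ha' T'
    have := hgain i hi
    rw [G.U_automatonPlan h0 h1 hR hV, G.U_automatonPlan h0 h1 hR hV, List.foldl_append] at this
    exact absurd this (not_lt.2 hle)

end Automaton

/-- Every number between two stage totals is, for high discount factors, the discounted value of a
sequence of stage totals whose continuation values never fall below it. -/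
lemma eventually_exists_discounted_sequence (s : A → ℝ) {lo hi : A} {X : ℝ} (hlo : s lo ≤ X)
    (hhi : X ≤ s hi) :
    ∀ᶠ δ in nhdsWithin (1 : ℝ) (Set.Iio 1), ∃ (a : ℕ → A) (y : ℕ → ℝ), y 0 = X ∧
      (∀ t, y t ∈ Set.Icc X (s hi)) ∧ ∀ t, y t = (1 - δ) * s (a t) + δ * y (t + 1) := by
  have hev : ∀ᶠ δ in nhdsWithin (1 : ℝ) (Set.Iio 1),
      X < s hi → (1 - δ) * (s hi - s lo) < δ * (s hi - X) := by
    by_cases hX : X < s hi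
    · refine Filter.Eventually.mono ?_ fun δ h _ => h
      refine nhdsWithin_le_nhds (ContinuousAt.eventually_lt (by fun_prop) (by fun_prop) ?_)
      linarith
    · exact Filter.Eventually.of_forall fun δ h => absurd h hX
  have hpos : ∀ᶠ δ in nhdsWithin (1 : ℝ) (Set.Iio 1), (0 : ℝ) < δ :=
    nhdsWithin_le_nhds (lt_mem_nhds one_pos)
  filter_upwards [hev, hpos, self_mem_nhdsWithin] with δ hδ h0 h1
  have h1 : δ < 1 := h1
  have step : ∀ y : Set.Icc X (s hi), ∃ p : A × Set.Icc X (s hi),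
      (y : ℝ) = (1 - δ) * s p.1 + δ * p.2 := by
    rintro ⟨y, hy1, hy2⟩
    -- Use `hi` whenever the continuation it requires is still at least `X`, and `lo` otherwise. In
    -- the second case `y` is close enough to `X` that, by `hδ`, the continuation does not exceed `s
    -- hi`.
    by_cases hc : δ * X ≤ y - (1 - δ) * s hi
    · refine ⟨(hi, ⟨(y - (1 - δ) * s hi) / δ, ?_, ?_⟩), ?_⟩
      · rw [le_div_iff₀ h0]; linarith
      · rw [div_le_iff₀ h0]; linarith
      · simp only; field_simp; ring
    · push Not at hc
      have hX : X < s hi := by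
        refine lt_of_le_of_ne hhi fun h => ?_
        rw [← h] at hc
        linarith
      have := hδ hX
      refine ⟨(lo, ⟨(y - (1 - δ) * s lo) / δ, ?_, ?_⟩), ?_⟩
      · rw [le_div_iff₀ h0]; nlinarith
      · rw [div_le_iff₀ h0]; linarith
      · simp only; field_simp; ring
  choose p hp using step
  let Y : ℕ → Set.Icc X (s hi) := fun t => (fun y => (p y).2)^[t] ⟨X, le_rfl, hhi⟩
  refine ⟨fun t => (p (Y t)).1, fun t => Y t, rfl, fun t => (Y t).2, fun t => ?_⟩
  have : Y (t + 1) = (p (Y t)).2 := Function.iterate_succ_apply' _ _ _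
  simp only [this]
  exact hp (Y t)

end SecretTransfers

/-! ### Conventions built from punishment paths. -/

namespace SecretTransfers

variable {ι A : Type*}

/-- After an unblocked outcome the current path is continued, after a deviation by a coalition in
`S` its own path is started, and after a deviation by another coalition that of a chosen single
player. -/
noncomputable def pathNext (S : Set (Finset ι)) (pick : Finset ι × ℕ → Outcome ι A → ι)
    (q : Finset ι × ℕ) (o : Outcome ι A) : Finset ι × ℕ :=
  open scoped Classical in
  if o.blocker = ∅ then (q.1, q.2 + 1) else
    if o.blocker ∈ S then (o.blocker, 0) else ({pick q o}, 0)

/-- For a blocker in `S` the transition does not read the transfers. For any other blocker nothing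
is secret, so the two outcomes coincide. -/
lemma pathNext_congr {S : Set (Finset ι)} (pick : Finset ι × ℕ → Outcome ι A → ι)
    (q : Finset ι × ℕ) {o o' : Outcome ι A} (h : SameUpToSecret S o o') :
    pathNext S pick q o = pathNext S pick q o' := by
  obtain ⟨ha, hb, ht⟩ := h
  by_cases hS : o.blocker ∈ S
  · simp only [pathNext, hS, ← hb, if_true]
    congr 1
    rw [hb]
  · have : o = o' := Outcome.ext ha hb (funext fun i => funext fun j => ht i j (Or.inl hS))
    rw [this]

lemma exists_le_of_sum_le_nonneg {s : Finset ι} (hs : s.Nonempty) {f : ι → ℝ} {K : ℝ}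
    (hK : 0 ≤ K) (h : ∑ i ∈ s, f i ≤ K) : ∃ i ∈ s, f i ≤ K := by
  by_contra! hlt
  obtain ⟨i, hi⟩ := hs
  have := Finset.single_le_sum (f := f) (fun j hj => hK.trans (hlt j hj).le) hi
  linarith [hlt i hi]

namespace StageGame

variable [Fintype ι] [DecidableEq ι]

/-- A coalition in `S` is deterred through its total, since one member fails to gain when the sum
does not rise. For other coalitions the scapegoat may depend on the observed transfers, so one
non-gaining member per deviation is enough. -/
lemma exists_isStableConvention_of_paths (G : StageGame ι A) {S : Set (Finset ι)} {δ : ℝ}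
    (h0 : 0 ≤ δ) (h1 : δ < 1) {alt : Finset ι → ℕ → A} {tr : Finset ι → ℕ → Transfers ι}
    {V : Finset ι → ℕ → ι → ℝ} {R : ℝ} (hR : ∀ c t i, |V c t i| ≤ R)
    (hV : ∀ c t i, V c t i = (1 - δ) * G.u (alt c t) (tr c t) i + δ * V c (t + 1) i)
    (hsecret : ∀ c t, ∀ C ∈ S, ∀ a' ∈ G.E C (alt c t), ∀ T' : Transfers ι,
      (1 - δ) * ∑ i ∈ C, G.u a' (deviate C T' (tr c t)) i + δ * ∑ i ∈ C, V C 0 i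
        ≤ ∑ i ∈ C, V c t i)
    (hpublic : ∀ c t, ∀ C ∉ S, C.Nonempty → ∀ a' ∈ G.E C (alt c t), ∀ T' : Transfers ι,
      ∃ i ∈ C, (1 - δ) * G.u a' (deviate C T' (tr c t)) i + δ * V {i} 0 i ≤ V c t i) :
    ∃ σ : Plan ι A, G.IsStableConvention S δ σ ∧ G.U δ σ [] = V ∅ 0 := by
  rcases isEmpty_or_nonempty ι with hι | hι
  · refine ⟨fun _ => ⟨alt ∅ 0, ∅, 0⟩, ⟨fun _ => rfl, ⟨fun _ i => isEmptyElim i, ?_⟩,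
      fun _ _ _ => rfl, ?_⟩, Subsingleton.elim _ _⟩
    · exact (Set.toFinite _).isBounded
    · rintro h ⟨C, a', T', ⟨i, -⟩, -⟩
      exact isEmptyElim i
  have hpick : ∀ (q : Finset ι × ℕ) (o : Outcome ι A), ∃ i : ι,
      (∃ i ∈ o.blocker, (1 - δ) * G.u o.alt o.transfers i + δ * V {i} 0 i ≤ V q.1 q.2 i) →
      i ∈ o.blocker ∧ (1 - δ) * G.u o.alt o.transfers i + δ * V {i} 0 i ≤ V q.1 q.2 i := by
    intro q o
    by_cases h : ∃ i ∈ o.blocker,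
        (1 - δ) * G.u o.alt o.transfers i + δ * V {i} 0 i ≤ V q.1 q.2 i
    · exact ⟨h.choose, fun _ => h.choose_spec⟩
    · exact ⟨Classical.arbitrary ι, fun h' => absurd h' h⟩
  choose pick hpick using hpick
  set out : Finset ι × ℕ → Outcome ι A := fun q => ⟨alt q.1 q.2, ∅, tr q.1 q.2⟩ with hout
  have hRq : ∀ (q : Finset ι × ℕ) i, |V q.1 q.2 i| ≤ R := fun q => hR q.1 q.2
  have hVq : ∀ (q : Finset ι × ℕ) i, V q.1 q.2 i
      = (1 - δ) * G.u (out q).alt (out q).transfers i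
        + δ * V (pathNext S pick q (out q)).1 (pathNext S pick q (out q)).2 i := by
    intro q i
    simpa [pathNext, hout] using hV q.1 q.2 i
  refine ⟨automatonPlan (pathNext S pick) out (∅, 0),
    G.isStableConvention_automatonPlan h0 h1 (V := fun q : Finset ι × ℕ => V q.1 q.2) hRq hVq (fun _ => rfl)
      (fun q _ _ h => pathNext_congr pick q h) (fun q C hC a' ha' T' => ?_),
    G.U_automatonPlan h0 h1 (V := fun q : Finset ι × ℕ => V q.1 q.2) hRq hVq []⟩
  have hC' : C ≠ ∅ := hC.ne_empty
  by_cases hCS : C ∈ S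
  · simp only [pathNext, hC', hCS, if_true, if_false]
    refine Finset.exists_le_of_sum_le hC ?_
    rw [Finset.sum_add_distrib, ← Finset.mul_sum, ← Finset.mul_sum]
    exact hsecret q.1 q.2 C hCS a' ha' T'
  · have := hpick q ⟨a', C, deviate C T' (tr q.1 q.2)⟩ (hpublic q.1 q.2 C hCS hC a' ha' T')
    refine ⟨_, this.1, ?_⟩
    simpa only [pathNext, hC', hCS, if_false] using this.2

/-- If for every coalition in `S` and every single player there is a path that holds it down to
its minmax for `L` periods, and that is worse for it than all other paths and the later periods of
the same path, then starting these paths after deviations gives a stable convention. -/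
lemma exists_isStableConvention_of_punishments (G : StageGame ι A) {S : Set (Finset ι)}
    {δ : ℝ} (h0 : 0 ≤ δ) (h1 : δ < 1) {alt : Finset ι → ℕ → A}
    {tr : Finset ι → ℕ → Transfers ι} {V : Finset ι → ℕ → ι → ℝ} {R : ℝ}
    (hR : ∀ c t i, |V c t i| ≤ R)
    (hV : ∀ c t i, V c t i = (1 - δ) * G.u (alt c t) (tr c t) i + δ * V c (t + 1) i)
    {L : ℕ} {K₀ K : ℝ} (hK : 0 ≤ K) (hK₀ : K₀ ≤ K) (hKm : ∀ i, K₀ - G.minmax {i} ≤ K)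
    (hgain : ∀ c t C a' T', ∑ i ∈ C, G.u a' (deviate C T' (tr c t)) i ≤ K₀)
    (hminmax : ∀ D ∈ S ∪ Set.range (fun i : ι => ({i} : Finset ι)), ∀ t < L,
      ∀ a' ∈ G.E D (alt D t), ∀ T', ∑ i ∈ D, G.u a' (deviate D T' (tr D t)) i ≤ G.minmax D)
    (hother : ∀ D ∈ S ∪ Set.range (fun i : ι => ({i} : Finset ι)), ∀ c t, (c = D → L ≤ t) →
      (1 - δ) * K + δ * ∑ i ∈ D, V D 0 i ≤ ∑ i ∈ D, V c t i)
    (hown : ∀ D ∈ S ∪ Set.range (fun i : ι => ({i} : Finset ι)), ∀ t < L,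
      (1 - δ) * G.minmax D + δ * ∑ i ∈ D, V D 0 i ≤ ∑ i ∈ D, V D t i) :
    ∃ σ : Plan ι A, G.IsStableConvention S δ σ ∧ G.U δ σ [] = V ∅ 0 := by
  have hδ : 0 ≤ 1 - δ := by linarith
  refine G.exists_isStableConvention_of_paths h0 h1 hR hV ?_ ?_
  · intro c t C hC a' ha' T'
    by_cases hc : c = C → L ≤ t
    · refine le_trans ?_ (hother C (Or.inl hC) c t hc)
      have := mul_le_mul_of_nonneg_left ((hgain c t C a' T').trans hK₀) hδ
      linarith
    · push Not at hc
      obtain ⟨rfl, ht⟩ := hc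
      refine le_trans ?_ (hown c (Or.inl hC) t ht)
      have := mul_le_mul_of_nonneg_left (hminmax c (Or.inl hC) t ht a' ha' T') hδ
      linarith
  · intro c t C _ hC a' ha' T'
    have hsingle : ∀ i : ι, ({i} : Finset ι) ∈ S ∪ Set.range (fun i : ι => ({i} : Finset ι)) :=
      fun i => Or.inr ⟨i, rfl⟩
    have hoth : ∀ i, (c = {i} → L ≤ t) → G.u a' (deviate C T' (tr c t)) i ≤ K →
        (1 - δ) * G.u a' (deviate C T' (tr c t)) i + δ * V {i} 0 i ≤ V c t i := by
      intro i hi hu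
      have h2 := hother {i} (hsingle i) c t hi
      simp only [Finset.sum_singleton] at h2
      have := mul_le_mul_of_nonneg_left hu hδ
      linarith
    by_cases hc : ∃ k ∈ C, c = {k} ∧ t < L
    · obtain ⟨k, hk, rfl, ht⟩ := hc
      by_cases hu : G.u a' (deviate C T' (tr {k} t)) k ≤ G.minmax {k}
      · refine ⟨k, hk, ?_⟩
        have h2 := hown {k} (hsingle k) t ht
        simp only [Finset.sum_singleton] at h2
        have := mul_le_mul_of_nonneg_left hu hδ
        linarith
      -- The player being minmaxed may profit, but not alone. What it takes above its minmax is lost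
      -- to its partners, whose total is then at most `K₀ - minmax {k} ≤ K`, so one of them can be
      -- punished instead.
      · have hne : (C.erase k).Nonempty := by
          rw [Finset.nonempty_iff_ne_empty]
          intro he
          have hCk : C = {k} := by
            rw [← Finset.insert_erase hk, he]; rfl
          subst hCk
          have := hminmax {k} (hsingle k) t ht a' ha' T'
          rw [Finset.sum_singleton] at this
          exact hu this
        have hsum : ∑ i ∈ C.erase k, G.u a' (deviate C T' (tr {k} t)) i ≤ K := by
          have h2 := hgain {k} t C a' T'
          have h3 := Finset.add_sum_erase C (G.u a' (deviate C T' (tr {k} t))) hk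
          have := hKm k
          linarith
        obtain ⟨j, hj, hju⟩ := exists_le_of_sum_le_nonneg hne hK hsum
        refine ⟨j, Finset.mem_of_mem_erase hj, hoth j (fun h => ?_) hju⟩
        exact absurd (Finset.singleton_injective h).symm (Finset.ne_of_mem_erase hj)
    · obtain ⟨j, hj, hju⟩ := exists_le_of_sum_le_nonneg hC hK ((hgain c t C a' T').trans hK₀)
      refine ⟨j, hj, hoth j (fun h => ?_) hju⟩
      by_contra ht
      exact hc ⟨j, hj, h, not_le.1 ht⟩

end StageGame

/-! ### Penalties and player-specific payoffs. -/

/-- Shift `ε` from the members of `D` to the other players, or destroy it if there are none. -/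
noncomputable def penalty [Fintype ι] [DecidableEq ι] (ε : ℝ) (D : Finset ι) (i : ι) : ℝ :=
  if i ∈ D then -(ε / D.card) else ε / Dᶜ.card

section Penalty

variable [Fintype ι] [DecidableEq ι] {ε : ℝ} {D : Finset ι}

lemma sum_penalty (hD : D.Nonempty) : ∑ i ∈ D, penalty ε D i = -ε := by
  have hc : (D.card : ℝ) ≠ 0 := by exact_mod_cast hD.card_pos.ne'
  have hin : ∀ i ∈ D, penalty ε D i = -(ε / D.card) := fun i hi => if_pos hi
  rw [Finset.sum_congr rfl hin, Finset.sum_const, nsmul_eq_mul]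
  field_simp

lemma sum_univ_penalty (hD : D.Nonempty) (hu : D ≠ Finset.univ) : ∑ i, penalty ε D i = 0 := by
  have hc : (Dᶜ.card : ℝ) ≠ 0 := by
    exact_mod_cast (Finset.card_pos.2 (Finset.nonempty_iff_ne_empty.2
      fun h => hu (by rwa [Finset.compl_eq_empty_iff] at h))).ne'
  have hout : ∀ i ∈ Dᶜ, penalty ε D i = ε / Dᶜ.card := fun i hi => if_neg (Finset.mem_compl.1 hi)
  rw [← Finset.sum_add_sum_compl D, sum_penalty hD, Finset.sum_congr rfl hout,
    Finset.sum_const, nsmul_eq_mul]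
  field_simp
  ring

/-- A proper subset of `D` bears only a fraction of the loss, and a set that reaches outside `D`
also receives part of the compensation. Hence `D` alone loses the full `ε`. -/
lemma neg_lt_sum_penalty (hε : 0 < ε) (hD : D.Nonempty) {C : Finset ι} (hne : C ≠ D) :
    -ε < ∑ i ∈ C, penalty ε D i := by
  have hc : (0 : ℝ) < D.card := by exact_mod_cast hD.card_pos
  have hsum : ∑ i ∈ C, penalty ε D i
      = -(ε * ((C ∩ D).card / D.card)) + (C \ D).card * (ε / Dᶜ.card) := by
    simp only [penalty]
    rw [Finset.sum_ite, Finset.sum_const, Finset.sum_const, nsmul_eq_mul, nsmul_eq_mul,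
      Finset.filter_mem_eq_inter, Finset.filter_notMem_eq_sdiff]
    ring
  rw [hsum]
  rcases Finset.eq_empty_or_nonempty (C \ D) with he | he
  · have hsub : C ⊆ D := Finset.sdiff_eq_empty_iff_subset.1 he
    have hlt : (C.card : ℝ) < D.card := by
      exact_mod_cast Finset.card_lt_card (hsub.ssubset_of_ne hne)
    rw [he, Finset.inter_eq_left.2 hsub]
    have := (div_lt_one hc).2 hlt
    simp only [Finset.card_empty, Nat.cast_zero, zero_mul, add_zero]
    nlinarith
  · have h1 : (0 : ℝ) < (C \ D).card := by exact_mod_cast he.card_pos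
    have h2 : (0 : ℝ) < Dᶜ.card := by
      obtain ⟨j, hj⟩ := he
      exact_mod_cast Finset.card_pos.2 ⟨j, Finset.mem_compl.2 (Finset.mem_sdiff.1 hj).2⟩
    have h3 : ((C ∩ D).card : ℝ) / D.card ≤ 1 :=
      (div_le_one hc).2 (by exact_mod_cast Finset.card_le_card Finset.inter_subset_right)
    have h4 : 0 < (C \ D).card * (ε / Dᶜ.card) := by positivity
    nlinarith

end Penalty

namespace StageGame

variable [Fintype ι] [DecidableEq ι] [Finite A] [Nonempty A]

lemma exists_punishment_payoffs (G : StageGame ι A) {P : Set (Finset ι)}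
    (hP : ∀ C ∈ P, C.Nonempty) {w : ι → ℝ} (hw : w ∈ G.feasible)
    (hm : ∀ C ∈ P, G.minmax C < ∑ i ∈ C, w i) :
    ∃ x : Finset ι → ι → ℝ, (∀ C ∉ P, x C = w) ∧
      (∀ C, ∃ lo hi, ∑ i, G.v lo i ≤ ∑ i, x C i ∧ ∑ i, x C i ≤ ∑ i, G.v hi i) ∧
      (∀ D ∈ P, G.minmax D < ∑ i ∈ D, x D i) ∧
      ∀ D ∈ P, ∀ c, c ≠ D → ∑ i ∈ D, x D i < ∑ i ∈ D, x c i := by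
  classical
  obtain ⟨ε, hεm, hε⟩ : ∃ ε : ℝ, (∀ D, D ∈ P → G.minmax D < ∑ i ∈ D, w i - ε) ∧ 0 < ε := by
    have : ∀ᶠ ε in nhdsWithin (0 : ℝ) (Set.Ioi 0), ∀ D, D ∈ P → G.minmax D < ∑ i ∈ D, w i - ε := by
      rw [Filter.eventually_all]
      intro D
      by_cases hD : D ∈ P
      · refine Filter.Eventually.mono ?_ fun ε h _ => h
        refine nhdsWithin_le_nhds (ContinuousAt.eventually_lt (by fun_prop) (by fun_prop) ?_)
        simpa using hm D hD
      · exact Filter.Eventually.of_forall fun ε h => absurd h hD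
    exact (this.and self_mem_nhdsWithin).exists
  set x : Finset ι → ι → ℝ := fun C => if C ∈ P then w + penalty ε C else w with hx
  have hin : ∀ C ∈ P, x C = w + penalty ε C := fun C hC => if_pos hC
  have hout : ∀ C ∉ P, x C = w := fun C hC => if_neg hC
  have hself : ∀ D ∈ P, ∑ i ∈ D, x D i = ∑ i ∈ D, w i - ε := fun D hD => by
    rw [hin D hD]
    simp only [Pi.add_apply, Finset.sum_add_distrib, sum_penalty (hP D hD)]
    ring
  obtain ⟨lo, hi, hlo, hhi⟩ := G.exists_le_sum_le_of_mem_feasible hw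
  refine ⟨x, hout, fun C => ?_, fun D hD => ?_, fun D hD c hc => ?_⟩
  · by_cases hC : C ∈ P
    · by_cases hu : C = Finset.univ
      · subst hu
        obtain ⟨a, ha⟩ := G.exists_forall_sum_le_minmax Finset.univ
        have h1 := ha a (G.refl _ (hP _ hC) a)
        have h2 := hεm _ hC
        have h3 := hself _ hC
        exact ⟨a, hi, by linarith, by linarith⟩
      · refine ⟨lo, hi, ?_⟩
        rw [hin C hC]
        simp only [Pi.add_apply, Finset.sum_add_distrib, sum_univ_penalty (hP C hC) hu, add_zero]
        exact ⟨hlo, hhi⟩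
    · rw [hout C hC]
      exact ⟨lo, hi, hlo, hhi⟩
  · rw [hself D hD]
    exact hεm D hD
  · rw [hself D hD]
    by_cases hcP : c ∈ P
    · rw [hin c hcP]
      simp only [Pi.add_apply, Finset.sum_add_distrib]
      linarith [neg_lt_sum_penalty hε (hP c hcP) hc.symm]
    · rw [hout c hcP]
      linarith

end StageGame

/-- Divided by `1 - δ`, the inequality compares `K - w` with `δ * (1 + δ + ... + δ ^ (L - 1)) * (w -
v)`, which tends to `L * (w - v)` as `δ → 1`. So `L` can be fixed before `δ`. -/
lemma eventually_punishment_deters {v w : ℝ} (hvw : v < w) (K : ℝ) :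
    ∀ᶠ L : ℕ in Filter.atTop, ∀ᶠ δ in nhdsWithin (1 : ℝ) (Set.Iio 1),
      (1 - δ) * K + δ * ((1 - δ ^ L) * v + δ ^ L * w) ≤ w := by
  obtain ⟨N, hN⟩ := exists_nat_gt ((K - w) / (w - v))
  filter_upwards [Filter.eventually_ge_atTop N] with L hL
  have hL' : K - w < L * (w - v) := by
    rw [← div_lt_iff₀ (by linarith)]
    exact hN.trans_le (by exact_mod_cast hL)
  have hev : ∀ᶠ δ in nhdsWithin (1 : ℝ) (Set.Iio 1),
      K - w < δ * (∑ k ∈ Finset.range L, δ ^ k) * (w - v) := by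
    refine nhdsWithin_le_nhds (ContinuousAt.eventually_lt (by fun_prop) (by fun_prop) ?_)
    simpa using hL'
  filter_upwards [hev, self_mem_nhdsWithin] with δ hδ h1
  have h1 : δ < 1 := h1
  have hgeom := mul_neg_geom_sum δ L
  have h2 := mul_le_mul_of_nonneg_left hδ.le (sub_nonneg.2 h1.le)
  have h3 : (1 - δ) * (δ * (∑ k ∈ Finset.range L, δ ^ k) * (w - v))
      = δ * (1 - δ ^ L) * (w - v) := by rw [← hgeom]; ring
  nlinarith

/-! ### Construction of the stable convention for patient players. -/

namespace StageGame

variable [Fintype ι] [DecidableEq ι] [Finite A] [Nonempty A]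

lemma eventually_exists_isStableConvention (G : StageGame ι A) {S : Set (Finset ι)}
    (hS : ∀ C ∈ S, C.Nonempty) {w : ι → ℝ} (hw : w ∈ G.strictlyRational S) :
    ∀ᶠ δ in nhdsWithin (1 : ℝ) (Set.Iio 1), ∃ σ : Plan ι A,
      G.IsStableConvention S δ σ ∧ G.U δ σ [] = w := by
  classical
  set P := S ∪ Set.range (fun i : ι => ({i} : Finset ι)) with hPdef
  have hP : ∀ C ∈ P, C.Nonempty := by
    rintro C (hC | ⟨i, rfl⟩)
    · exact hS C hC
    · exact Finset.singleton_nonempty i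
  obtain ⟨x, hxout, hxfeas, hxm, hxlt⟩ := G.exists_punishment_payoffs hP hw.1 hw.2
  choose mm hmm using G.exists_forall_sum_le_minmax
  have hvm : ∀ D ∈ P, ∑ i ∈ D, G.v (mm D) i ≤ G.minmax D := fun D hD =>
    hmm D _ (G.refl D (hP D hD) _)
  have hvx : ∀ D ∈ P, ∑ i ∈ D, G.v (mm D) i < ∑ i ∈ D, x D i := fun D hD =>
    (hvm D hD).trans_lt (hxm D hD)
  -- Transfers implement `x c` plus an equal share of the gap between the total generated by `a` and
  -- that of `x c`. Only the scalar total then varies along a path.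
  set r : Finset ι → A → ι → ℝ := fun c a i =>
    x c i + (∑ j, G.v a j - ∑ j, x c j) / Fintype.card ι with hr
  set T : Finset ι → A → Transfers ι := fun c a =>
    innerTransfers Finset.univ (r c a - G.v a) with hT
  have hrsum : ∀ c a, ∑ i, r c a i = ∑ i, G.v a i := by
    intro c a
    rcases isEmpty_or_nonempty ι with hι | hι
    · simp
    have hn : (Fintype.card ι : ℝ) ≠ 0 := by exact_mod_cast Fintype.card_ne_zero
    simp only [hr, Finset.sum_add_distrib, Finset.sum_const, Finset.card_univ, nsmul_eq_mul]
    field_simp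
    ring
  have hTu : ∀ c a, G.u a (T c a) = r c a := fun c a => G.u_innerTransfers_univ a (hrsum c a)
  obtain ⟨B₁, hB₁⟩ := (Set.finite_range fun p : Finset ι × A =>
    ∑ i, ∑ j, (T p.1 p.2 i j : ℝ)).bddAbove
  obtain ⟨B₂, hB₂⟩ := (Set.finite_range fun p : Finset ι × A => ∑ i ∈ p.1, G.v p.2 i).bddAbove
  obtain ⟨B₃, hB₃⟩ := (Set.finite_range fun C : Finset ι => -G.minmax C).bddAbove
  have hB₁ : ∀ c a, ∑ i, ∑ j, (T c a i j : ℝ) ≤ B₁ := fun c a => hB₁ ⟨(c, a), rfl⟩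
  have hB₂ : ∀ C a, ∑ i ∈ C, G.v a i ≤ B₂ := fun C a => hB₂ ⟨(C, a), rfl⟩
  have hB₃ : ∀ C, -G.minmax C ≤ B₃ := fun C => hB₃ ⟨C, rfl⟩
  -- The first two terms bound what any deviating coalition can earn in total. The third covers
  -- `-minmax {k}`, for the case where the minmaxed player takes part in the deviation.
  set K := |B₂| + |B₁| + |B₃| with hK
  obtain ⟨L, hL⟩ : ∃ L : ℕ, ∀ D, D ∈ P → ∀ᶠ δ in nhdsWithin (1 : ℝ) (Set.Iio 1),
      (1 - δ) * K + δ * ((1 - δ ^ L) * ∑ i ∈ D, G.v (mm D) i + δ ^ L * ∑ i ∈ D, x D i)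
        ≤ ∑ i ∈ D, x D i := by
    refine Filter.Eventually.exists (f := Filter.atTop) (Filter.eventually_all.2 fun D => ?_)
    by_cases hD : D ∈ P
    · exact (eventually_punishment_deters (hvx D hD) K).mono fun L h _ => h
    · exact Filter.Eventually.of_forall fun L h => absurd h hD
  have ev1 : ∀ᶠ δ in nhdsWithin (1 : ℝ) (Set.Iio 1), ∀ D, D ∈ P →
      (1 - δ) * K + δ * ((1 - δ ^ L) * ∑ i ∈ D, G.v (mm D) i + δ ^ L * ∑ i ∈ D, x D i)
        ≤ ∑ i ∈ D, x D i := by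
    refine Filter.eventually_all.2 fun D => ?_
    by_cases hD : D ∈ P
    · exact (hL D hD).mono fun δ h _ => h
    · exact Filter.Eventually.of_forall fun δ h => absurd h hD
  -- `k` is the number of minmax periods left on path `c`. At `δ = 1` they have no weight and the
  -- claim reduces to `hxlt`; continuity and finiteness do the rest.
  have ev2 : ∀ᶠ δ in nhdsWithin (1 : ℝ) (Set.Iio 1), ∀ (D c : Finset ι) (k : Fin (L + 1)),
      D ∈ P → c ≠ D →
      (1 - δ) * K + δ * ((1 - δ ^ L) * ∑ i ∈ D, G.v (mm D) i + δ ^ L * ∑ i ∈ D, x D i)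
        < (1 - δ ^ (k : ℕ)) * ∑ i ∈ D, G.v (mm c) i + δ ^ (k : ℕ) * ∑ i ∈ D, x c i := by
    refine Filter.eventually_all.2 fun D => Filter.eventually_all.2 fun c =>
      Filter.eventually_all.2 fun k => ?_
    by_cases h : D ∈ P ∧ c ≠ D
    · refine Filter.Eventually.mono ?_ fun δ h _ _ => h
      refine nhdsWithin_le_nhds (ContinuousAt.eventually_lt (by fun_prop) (by fun_prop) ?_)
      simpa using hxlt D h.1 c h.2
    · exact Filter.Eventually.of_forall fun δ h1 h2 => absurd ⟨h1, h2⟩ h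
  have ev3 : ∀ᶠ δ in nhdsWithin (1 : ℝ) (Set.Iio 1), ∀ D, D ∈ P →
      G.minmax D < (1 - δ ^ L) * ∑ i ∈ D, G.v (mm D) i + δ ^ L * ∑ i ∈ D, x D i := by
    refine Filter.eventually_all.2 fun D => ?_
    by_cases hD : D ∈ P
    · refine Filter.Eventually.mono ?_ fun δ h _ => h
      refine nhdsWithin_le_nhds (ContinuousAt.eventually_lt (by fun_prop) (by fun_prop) ?_)
      simpa using hxm D hD
    · exact Filter.Eventually.of_forall fun δ h => absurd h hD
  choose lo hi hlo hhi using hxfeas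
  have ev4 : ∀ᶠ δ in nhdsWithin (1 : ℝ) (Set.Iio 1), ∀ c : Finset ι,
      ∃ (a : ℕ → A) (y : ℕ → ℝ), y 0 = ∑ i, x c i ∧
      (∀ t, y t ∈ Set.Icc (∑ i, x c i) (∑ i, G.v (hi c) i)) ∧
      ∀ t, y t = (1 - δ) * ∑ i, G.v (a t) i + δ * y (t + 1) :=
    Filter.eventually_all.2 fun c =>
      eventually_exists_discounted_sequence (fun a => ∑ i, G.v a i) (hlo c) (hhi c)
  have evpos : ∀ᶠ δ in nhdsWithin (1 : ℝ) (Set.Iio 1), (0 : ℝ) < δ :=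
    nhdsWithin_le_nhds (lt_mem_nhds one_pos)
  filter_upwards [ev1, ev2, ev3, ev4, evpos, self_mem_nhdsWithin] with δ h1 h2 h3 h4 hδ0 hδ1
  have hδ1 : δ < 1 := hδ1
  choose a y hy0 hyb hy using h4
  -- Paths outside `P` have no minmax phase. One of them is `∅`, the equilibrium path, with value
  -- `w`.
  set len : Finset ι → ℕ := fun c => if c ∈ P then L else 0 with hlen
  have hlenP : ∀ c ∈ P, len c = L := fun c hc => if_pos hc
  have hlen' : ∀ c ∉ P, len c = 0 := fun c hc => if_neg hc
  have hlenL : ∀ c, len c ≤ L := fun c => by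
    simp only [hlen]; split_ifs <;> omega
  set W : Finset ι → ℕ → ι → ℝ := fun c t i =>
    x c i + (y c t - ∑ j, x c j) / Fintype.card ι with hW
  set V : Finset ι → ℕ → ι → ℝ := fun c t i =>
    (1 - δ ^ (len c - t)) * G.v (mm c) i + δ ^ (len c - t) * W c (t - len c) i with hVdef
  have hW0 : ∀ c i, W c 0 i = x c i := fun c i => by simp [hW, hy0]
  -- This is why the totals `y` must never fall below their initial value: equal sharing then keeps
  -- every player at or above `x c`.
  have hWge : ∀ c t i, x c i ≤ W c t i := fun c t i => by
    have := (hyb c t).1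
    simp only [hW, le_add_iff_nonneg_right]
    exact div_nonneg (by linarith) (Nat.cast_nonneg _)
  have hVsum : ∀ c t (D : Finset ι), (1 - δ ^ (len c - t)) * ∑ i ∈ D, G.v (mm c) i
      + δ ^ (len c - t) * ∑ i ∈ D, x c i ≤ ∑ i ∈ D, V c t i := by
    intro c t D
    simp only [hVdef, Finset.sum_add_distrib, ← Finset.mul_sum]
    gcongr with i
    exact hWge _ _ _
  have hV0 : ∀ D ∈ P, ∑ i ∈ D, V D 0 i
      = (1 - δ ^ L) * ∑ i ∈ D, G.v (mm D) i + δ ^ L * ∑ i ∈ D, x D i := by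
    intro D hD
    simp only [hVdef, Nat.zero_sub, Nat.sub_zero, hW0, hlenP D hD, Finset.sum_add_distrib,
      ← Finset.mul_sum]
  have hVbdd : ∃ R, ∀ c t i, |V c t i| ≤ R := by
    obtain ⟨Rx, hRx⟩ := (Set.finite_range fun p : Finset ι × ι =>
      |G.v (mm p.1) p.2| + |x p.1 p.2| + (∑ j, G.v (hi p.1) j - ∑ j, x p.1 j) /
        Fintype.card ι).bddAbove
    refine ⟨Rx, fun c t i => ?_⟩
    refine le_trans ?_ (hRx ⟨(c, i), rfl⟩)
    have hp0 : 0 ≤ δ ^ (len c - t) := pow_nonneg hδ0.le _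
    have hp1 : δ ^ (len c - t) ≤ 1 := pow_le_one₀ hδ0.le hδ1.le
    have hWabs : |W c (t - len c) i| ≤ |x c i| + (∑ j, G.v (hi c) j - ∑ j, x c j) /
        Fintype.card ι := by
      have hyb' := hyb c (t - len c)
      refine (abs_add_le _ _).trans ?_
      gcongr
      rw [abs_of_nonneg (div_nonneg (by linarith [hyb'.1]) (Nat.cast_nonneg _))]
      gcongr
      exact hyb'.2
    simp only [hVdef]
    refine (abs_add_le _ _).trans ?_
    rw [abs_mul, abs_mul, abs_of_nonneg hp0, abs_of_nonneg (sub_nonneg.2 hp1), add_assoc]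
    exact add_le_add (mul_le_of_le_one_left (abs_nonneg _) (by linarith))
      ((mul_le_of_le_one_left (abs_nonneg _) hp1).trans hWabs)
  obtain ⟨R, hR⟩ := hVbdd
  set alt : Finset ι → ℕ → A := fun c t => if t < len c then mm c else a c (t - len c) with halt
  set tr : Finset ι → ℕ → Transfers ι := fun c t =>
    if t < len c then 0 else T c (a c (t - len c)) with htr
  have hgain0 : ∀ (C : Finset ι) (a' : A) T', ∑ i ∈ C, G.u a' (deviate C T' 0) i
      ≤ ∑ i ∈ C, G.v a' i := fun C a' T' => by
    simpa using G.sum_u_deviate_le a' C T' 0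
  have hVinit : V ∅ 0 = w := by
    have : (∅ : Finset ι) ∉ P := fun h => (hP _ h).ne_empty rfl
    funext i
    simp [hVdef, hlen' _ this, hW0, hxout _ this]
  rw [← hVinit]
  refine G.exists_isStableConvention_of_punishments hδ0.le hδ1 (alt := alt) (tr := tr) hR ?_
    (L := L) (K₀ := |B₂| + |B₁|) (K := K) (by positivity) ?_ ?_ ?_ ?_ ?_ ?_
  · intro c t i
    by_cases ht : t < len c
    · obtain ⟨k, hk⟩ : ∃ k, len c - t = k + 1 := ⟨len c - t - 1, by omega⟩
      have hk' : len c - (t + 1) = k := by omega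
      have e1 : t - len c = 0 := by omega
      have e2 : t + 1 - len c = 0 := by omega
      simp only [hVdef, halt, htr, if_pos ht, hk, hk', e1, e2, u, Pi.zero_apply, NNReal.coe_zero,
        Finset.sum_const_zero]
      ring
    · have e1 : t + 1 - len c = t - len c + 1 := by omega
      have e2 : len c - t = 0 := by omega
      have e3 : len c - (t + 1) = 0 := by omega
      simp only [hVdef, halt, htr, if_neg ht, hTu, e1, e2, e3, pow_zero, sub_self, zero_mul,
        zero_add, one_mul, hW, hr]
      rw [hy c (t - len c)]
      ring
  · linarith [abs_nonneg B₃]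
  · intro i
    linarith [hB₃ {i}, le_abs_self B₃]
  · intro c t C a' T'
    by_cases ht : t < len c
    · simp only [htr, if_pos ht]
      linarith [hgain0 C a' T', hB₂ C a', le_abs_self B₂, abs_nonneg B₁]
    · simp only [htr, if_neg ht]
      linarith [G.sum_u_deviate_le a' C T' (T c (a c (t - len c))), hB₂ C a', le_abs_self B₂,
        hB₁ c (a c (t - len c)), le_abs_self B₁]
  · intro D hD t ht a' ha' T'
    have ht' : t < len D := by rwa [hlenP D hD]
    simp only [htr, halt, if_pos ht'] at ha' ⊢
    exact (hgain0 D a' T').trans (hmm D a' ha')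
  · intro D hD c t hc
    rw [hV0 D hD]
    by_cases hcD : c = D
    · subst hcD
      have e : len c - t = 0 := by have := hc rfl; have := hlenL c; omega
      have h5 := hVsum c t c
      rw [e, pow_zero, sub_self, zero_mul, zero_add, one_mul] at h5
      exact (h1 c hD).trans h5
    · have hk : len c - t < L + 1 := by have := hlenL c; omega
      exact (h2 D c ⟨_, hk⟩ hD hcD).le.trans (hVsum c t D)
  · intro D hD t ht
    have h5 := hVsum D t D
    rw [hV0 D hD]
    rw [hlenP D hD] at h5
    refine le_trans ?_ h5
    -- With fewer minmax periods left, the value of `D` is at least its value at the start of its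
    -- path, which by `h3` exceeds its minmax. Restarting the path therefore does not pay.
    have h6 : δ ^ L ≤ δ ^ (L - t) := pow_le_pow_of_le_one hδ0.le hδ1.le (by omega)
    have h7 := mul_le_mul_of_nonneg_right h6 (sub_nonneg.2 (hvx D hD).le)
    have h8 := mul_le_mul_of_nonneg_left (h3 D hD).le (sub_nonneg.2 hδ1.le)
    linarith

end StageGame

end SecretTransfers

theorem theorem5 {ι A : Type*} [Fintype ι] [DecidableEq ι] [Finite A] [Nonempty A]
    (G : SecretTransfers.StageGame ι A) (S : Set (Finset ι)) (hS : ∀ C ∈ S, C.Nonempty) :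
    (∀ δ : ℝ, 0 ≤ δ → δ < 1 → ∀ σ : SecretTransfers.Plan ι A,
      G.IsStableConvention S δ σ → G.U δ σ [] ∈ G.rational S) ∧
    ((G.strictlyRational S).Nonempty → ∀ w ∈ G.strictlyRational S,
      ∃ δ₀ : ℝ, 0 ≤ δ₀ ∧ δ₀ < 1 ∧ ∀ δ ∈ Set.Ioo δ₀ 1, ∃ σ : SecretTransfers.Plan ι A,
        G.IsStableConvention S δ σ ∧ G.U δ σ [] = w) := by
  refine ⟨fun δ h0 h1 σ hσ => hσ.U_mem_rational hS h0 h1 [], fun _ w hw => ?_⟩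
  obtain ⟨l, hl, hsub⟩ := mem_nhdsLT_iff_exists_Ioo_subset.1
    (G.eventually_exists_isStableConvention hS hw)
  refine ⟨max l 0, le_max_right _ _, max_lt hl one_pos, fun δ hδ => ?_⟩
  exact hsub ⟨(le_max_left _ _).trans_lt hδ.1, hδ.2⟩
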